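/- Let $\mathbb F_q$ be a finite field with $q$ elements, let $F:\mathbb F_q\times\mathbb F_q\to\mathbb F_q$ be any function, and let $(S_{1,i},S_{2,i})$, $i=1,2,\dots$, be i.i.d. pairs with an arbitrary joint distribution on $\mathbb F_q\times\mathbb F_q$ (in particular, $S_1$ and $S_2$ may be independent). Consider the channel $Y_i=X_i+F(S_{1,i},S_{2,i})$ in which the whole sequence $S_1^n$ is available at the encoder and $S_2^n$ at the decoder. A code of length $n$ and rate $R\ge 0$ consists of an encoder $f:\mathcal M\times\mathbb F_q^n\to\mathbb F_q^n$ and a decoder $\phi:\mathbb F_q^n\times\mathbb F_q^n\to\mathcal M$, where $|\mathcal M|=\lceil 2^{nR}\rceil$. Its error probability is $P_e=\Pr[\phi(Y^n,S_2^n)\ne M]$, where $M$ is uniform on $\mathcal M$ and independent of the states, and $X^n=f(M,S_1^n)$. The rate $R$ is achievable if for every $\varepsilon>0$ and all sufficiently large $n$ there is such a code with $P_e\le\varepsilon$. The capacity $\mathbf C$ is the least upper bound of the achievable rates. Then $$\mathbf C=\log_2 q-\inf_{n\ge 1}\ \inf_{g:\mathbb F_q^n\to\mathbb F_q^n}\ \frac1n\,H\bigl(g(S_1^n)+F(S_1^n,S_2^n)\,\big|\,S_2^n\bigr),$$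 where $F$ is applied componentwise, $H(\cdot\,|\,S_2^n)$ is the (average) conditional Shannon entropy in bits given $S_2^n$, and the infimum is over all block lengths $n\ge1$ and all functions $g$. -/

import Mathlib

namespace TwoStateChannel

/-! ### Finite probability -/

/-- Probability of the event `E` under the probability mass function `P` on a finite set. -/
noncomputable def prob {Ω : Type*} [Fintype Ω] (P : Ω → ℝ) (E : Set Ω) : ℝ :=
  ∑ ω, E.indicator P ω

/-- Conditional probability `P(A | B)` (only used with weight `P(B)`, so that its value for
`P(B) = 0` does not matter). -/
noncomputable def condProb {Ω : Type*} [Fintype Ω] (P : Ω → ℝ) (A B : Set Ω) : ℝ :=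
  prob P (A ∩ B) / prob P B

/-- The (average) conditional Shannon entropy in bits,
`H(Z | S) = ∑ s, P(S = s) * ∑ z, - P(Z = z | S = s) * log₂ P(Z = z | S = s)`
of random variables `Z`, `S` on the finite probability space `(Ω, P)`. -/
noncomputable def condEntropy {Ω α β : Type*} [Fintype Ω] [Fintype α] [Fintype β]
    (P : Ω → ℝ) (Z : Ω → α) (S : Ω → β) : ℝ :=
  ∑ s, prob P {ω | S ω = s} *
    ∑ z, -(condProb P {ω | Z ω = z} {ω | S ω = s} *
      Real.logb 2 (condProb P {ω | Z ω = z} {ω | S ω = s}))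

/-! ### The channel `Y = X + F(S₁, S₂)` -/

variable {K : Type*} [Field K] [Fintype K]

/-- Joint law of the state sequences `(S₁ⁿ, S₂ⁿ)`: the pairs `(S₁ᵢ, S₂ᵢ)`, `i = 1, …, n`, are
independent, each with joint law `p`. -/
noncomputable def stateLaw (p : PMF (K × K)) (n : ℕ) (s : (Fin n → K) × (Fin n → K)) : ℝ :=
  ∏ i, (p (s.1 i, s.2 i)).toReal

/-- The output sequence of the channel, `Yᵢ = Xᵢ + F(S₁ᵢ, S₂ᵢ)`. -/
def output (F : K → K → K) {n : ℕ} (x s₁ s₂ : Fin n → K) : Fin n → K :=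
  fun i => x i + F (s₁ i) (s₂ i)

/-- Joint law of the message, uniform on `Fin m`, and the state sequences, which are independent
of the message. -/
noncomputable def messageStateLaw (p : PMF (K × K)) (n m : ℕ)
    (ω : Fin m × ((Fin n → K) × (Fin n → K))) : ℝ :=
  (1 / (m : ℝ)) * stateLaw p n ω.2

/-- The error probability `P(dec(Yⁿ, S₂ⁿ) ≠ M)`, where `Xⁿ = enc(M, S₁ⁿ)`. -/
noncomputable def errorProb (p : PMF (K × K)) (F : K → K → K) {n m : ℕ}
    (enc : Fin m → (Fin n → K) → (Fin n → K))
    (dec : (Fin n → K) → (Fin n → K) → Fin m) : ℝ :=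
  prob (messageStateLaw p n m)
    {ω | dec (output F (enc ω.1 ω.2.1) ω.2.1 ω.2.2) ω.2.2 ≠ ω.1}

/-- The rate `R ≥ 0` (in bits per channel use) is achievable: for every `ε > 0` and all large
enough `n` there are an encoder, which knows `S₁ⁿ`, and a decoder, which knows `S₂ⁿ`, for a message
space of size `2 ^ (n R)` (rounded up), with error probability at most `ε`. -/
def IsAchievable (p : PMF (K × K)) (F : K → K → K) (R : ℝ) : Prop :=
  0 ≤ R ∧ ∀ ε : ℝ, 0 < ε → ∃ N : ℕ, ∀ n : ℕ, N ≤ n →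
    ∃ (enc : Fin ⌈(2 : ℝ) ^ ((n : ℝ) * R)⌉₊ → (Fin n → K) → (Fin n → K))
      (dec : (Fin n → K) → (Fin n → K) → Fin ⌈(2 : ℝ) ^ ((n : ℝ) * R)⌉₊),
      errorProb p F enc dec ≤ ε

/-- `C` is the capacity: the least upper bound of the achievable rates. -/
def IsCapacity (p : PMF (K × K)) (F : K → K → K) (C : ℝ) : Prop :=
  IsLUB {R : ℝ | IsAchievable p F R} C

/-- The normalized entropy `(1 / n) * H(g(S₁ⁿ) + F(S₁ⁿ, S₂ⁿ) | S₂ⁿ)`. -/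
noncomputable def entropyRate (p : PMF (K × K)) (F : K → K → K) (n : ℕ)
    (g : (Fin n → K) → (Fin n → K)) : ℝ :=
  (1 / (n : ℝ)) *
    condEntropy (stateLaw p n) (fun s => output F (g s.1) s.1 s.2) (fun s => s.2)

/-- The values of the normalized entropy over all block lengths `n ≥ 1` and all functions
`g : Kⁿ → Kⁿ`. -/
def entropyRates (p : PMF (K × K)) (F : K → K → K) : Set ℝ :=
  {h | ∃ n : ℕ, 1 ≤ n ∧ ∃ g : (Fin n → K) → (Fin n → K), h = entropyRate p F n g}

end TwoStateChannel

/-! Achievability: sending `u + g(S₁)` for a codeword `u` yields `Y = u + Z` with additive noise `Z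
= g(S₁) + F(S₁, S₂)` independent of `u`. Applying `g` blockwise makes the pairs of noise and decoder
state i.i.d. across blocks. For any `c > H(Z | S₂)`, a Chernoff bound confines the noise, given
`S₂`, to about `2 ^ c` values per block (`exists_typical_set`). Random codewords then reach every
nonnegative rate below `log q - H(Z | S₂) / n` (`exists_code`, `isAchievable_of_lt`).

Converse: for a fixed message the encoder is itself a map `g`, so given the message and `S₂` the
output has entropy at least `n h`, with `h` the infimum. At most `n log q` bits fit in the output,
which leaves `n (log q - h)` for the message. A Gibbs inequality for each message makes this precise
up to an additive constant (`one_sub_errorProb_mul_logb_le`), which disappears after division by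
`n`. -/

namespace TwoStateChannel

open Finset Filter Topology

/-! ### Conditional probability, conditional entropy and Gibbs' inequality -/

section FiniteProbability

variable {Ω α β : Type*} [Fintype Ω] [Fintype α] [Fintype β]

theorem prob_nonneg {P : Ω → ℝ} (hP : ∀ ω, 0 ≤ P ω) (E : Set Ω) : 0 ≤ prob P E :=
  sum_nonneg fun ω _ => Set.indicator_nonneg (fun ω _ => hP ω) ω

theorem prob_mono {P : Ω → ℝ} (hP : ∀ ω, 0 ≤ P ω) {E E' : Set Ω} (h : E ⊆ E') :
    prob P E ≤ prob P E' :=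
  sum_le_sum fun ω _ => Set.indicator_le_indicator_of_subset h hP ω

theorem le_prob_of_mem {P : Ω → ℝ} (hP : ∀ ω, 0 ≤ P ω) {E : Set Ω} {ω : Ω} (h : ω ∈ E) :
    P ω ≤ prob P E := by
  have := single_le_sum (f := fun ω => E.indicator P ω) (s := univ)
    (fun ω _ => Set.indicator_nonneg (fun ω _ => hP ω) ω) (mem_univ ω)
  simpa [prob, h] using this

theorem sum_prob_inter (P : Ω → ℝ) (Z : Ω → α) (B : Set Ω) :
    ∑ z, prob P ({ω | Z ω = z} ∩ B) = prob P B := by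
  classical
  unfold prob
  rw [sum_comm]
  refine sum_congr rfl fun ω _ => ?_
  by_cases h : ω ∈ B <;> simp [Set.indicator_apply, h]

theorem prob_mul_condProb {P : Ω → ℝ} (hP : ∀ ω, 0 ≤ P ω) (A B : Set Ω) :
    prob P B * condProb P A B = prob P (A ∩ B) := by
  unfold condProb
  rcases eq_or_ne (prob P B) 0 with h | h
  · have h1 := prob_mono hP (Set.inter_subset_right : A ∩ B ⊆ B)
    have h2 := prob_nonneg hP (A ∩ B)
    rw [h, zero_mul]
    linarith
  · field_simp

theorem condProb_nonneg {P : Ω → ℝ} (hP : ∀ ω, 0 ≤ P ω) (A B : Set Ω) : 0 ≤ condProb P A B :=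
  div_nonneg (prob_nonneg hP _) (prob_nonneg hP _)

theorem condProb_le_one {P : Ω → ℝ} (hP : ∀ ω, 0 ≤ P ω) (A B : Set Ω) : condProb P A B ≤ 1 :=
  div_le_one_of_le₀ (prob_mono hP Set.inter_subset_right) (prob_nonneg hP _)

theorem condProb_pos {P : Ω → ℝ} (hP : ∀ ω, 0 ≤ P ω) {A B : Set Ω} {ω : Ω} (h : 0 < P ω)
    (hA : ω ∈ A) (hB : ω ∈ B) : 0 < condProb P A B :=
  div_pos (h.trans_le (le_prob_of_mem hP ⟨hA, hB⟩)) (h.trans_le (le_prob_of_mem hP hB))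

/-- Equality can fail only if `B` has probability zero, where division by zero makes every term 0.
-/
theorem sum_condProb_le_one {P : Ω → ℝ} (Z : Ω → α) (B : Set Ω) :
    ∑ z, condProb P {ω | Z ω = z} B ≤ 1 := by
  unfold condProb
  rw [← sum_div, sum_prob_inter]
  exact div_self_le_one _

/-- The law of total expectation. -/
theorem sum_prob_mul_sum_condProb_mul {P : Ω → ℝ} (hP : ∀ ω, 0 ≤ P ω) (Z : Ω → α) (S : Ω → β)
    (f : β → α → ℝ) :
    ∑ s, prob P {ω | S ω = s} * ∑ z, condProb P {ω | Z ω = z} {ω | S ω = s} * f s z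
      = ∑ ω, P ω * f (S ω) (Z ω) := by
  classical
  calc _ = ∑ s, ∑ z, prob P ({ω | Z ω = z} ∩ {ω | S ω = s}) * f s z := by
        refine sum_congr rfl fun s _ => ?_
        rw [mul_sum]
        refine sum_congr rfl fun z _ => ?_
        rw [← mul_assoc, prob_mul_condProb hP]
    _ = ∑ ω, ∑ s, ∑ z, ({ω | Z ω = z} ∩ {ω | S ω = s}).indicator P ω * f s z := by
        rw [sum_comm]
        simp_rw [prob, sum_mul]
        rw [sum_comm]
        simp_rw [sum_comm (s := (univ : Finset Ω))]
    _ = _ := by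
        refine sum_congr rfl fun ω _ => ?_
        rw [sum_eq_single (S ω), sum_eq_single (Z ω)]
        · simp
        · intro z _ hz
          simp [hz.symm]
        · simp
        · intro s _ hs
          simp [hs.symm]
        · simp

/-- The conditional entropy is the expectation of the conditional information density. -/
theorem condEntropy_eq_sum {P : Ω → ℝ} (hP : ∀ ω, 0 ≤ P ω) (Z : Ω → α) (S : Ω → β) :
    condEntropy P Z S =
      ∑ ω, P ω * -Real.logb 2 (condProb P {ω' | Z ω' = Z ω} {ω' | S ω' = S ω}) := by
  rw [← sum_prob_mul_sum_condProb_mul hP Z S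
    (fun s z => -Real.logb 2 (condProb P {ω' | Z ω' = z} {ω' | S ω' = s}))]
  simp only [condEntropy, mul_neg]

theorem condEntropy_nonneg {P : Ω → ℝ} (hP : ∀ ω, 0 ≤ P ω) (Z : Ω → α) (S : Ω → β) :
    0 ≤ condEntropy P Z S := by
  rw [condEntropy_eq_sum hP]
  refine sum_nonneg fun ω _ => mul_nonneg (hP ω) (neg_nonneg.2 ?_)
  exact Real.logb_nonpos one_lt_two (condProb_nonneg hP _ _) (condProb_le_one hP _ _)

/-- This is `log x ≤ x - 1` at `x = w / p`. The linear correction is kept because the weights `w`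
need not sum to 1. -/
theorem neg_mul_logb_le {p w : ℝ} (hp : 0 ≤ p) (hw : 0 < w) :
    -(p * Real.logb 2 p) ≤ p * -Real.logb 2 w + (w - p) / Real.log 2 := by
  have h2 : 0 < Real.log 2 := Real.log_pos one_lt_two
  rcases hp.eq_or_lt with rfl | hp
  · simp only [zero_mul, neg_zero, sub_zero, zero_add]
    positivity
  · have h := Real.log_le_sub_one_of_pos (div_pos hw hp)
    rw [Real.log_div hw.ne' hp.ne'] at h
    have h' : p * (Real.log w - Real.log p) ≤ w - p := by
      calc _ ≤ p * (w / p - 1) := mul_le_mul_of_nonneg_left h hp.le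
        _ = w - p := by field_simp
    unfold Real.logb
    have : (p * (Real.log w - Real.log p)) / Real.log 2 ≤ (w - p) / Real.log 2 := by gcongr
    have e : (p * (Real.log w - Real.log p)) / Real.log 2
      = p * (Real.log w / Real.log 2) - p * (Real.log p / Real.log 2) := by ring
    linarith

/-- Gibbs' inequality for the conditional entropy, with unnormalized weights. -/
theorem condEntropy_le {P : Ω → ℝ} (hP : ∀ ω, 0 ≤ P ω) (hP1 : ∑ ω, P ω = 1) (Z : Ω → α)
    (S : Ω → β) {w : β → α → ℝ} (hw : ∀ s z, 0 < w s z) :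
    condEntropy P Z S ≤ ∑ ω, P ω * -Real.logb 2 (w (S ω) (Z ω)) +
      (∑ s, prob P {ω | S ω = s} * ∑ z, w s z - 1) / Real.log 2 := by
  have h1 := sum_prob_mul_sum_condProb_mul hP Z S (fun _ _ => 1)
  simp only [mul_one, hP1] at h1
  rw [← sum_prob_mul_sum_condProb_mul hP Z S (fun s z => -Real.logb 2 (w s z)), ← h1,
    ← sum_sub_distrib, sum_div, ← sum_add_distrib]
  refine sum_le_sum fun s _ => ?_
  rw [← mul_sub, mul_div_assoc, ← mul_add, ← sum_sub_distrib, sum_div, ← sum_add_distrib]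
  refine mul_le_mul_of_nonneg_left (sum_le_sum fun z _ => ?_) (prob_nonneg hP _)
  exact neg_mul_logb_le (condProb_nonneg hP _ _) (hw s z)

theorem sum_prob_fiber (P : Ω → ℝ) (S : Ω → β) : ∑ s, prob P {ω | S ω = s} = ∑ ω, P ω := by
  have := sum_prob_inter P S Set.univ
  simpa [prob] using this

end FiniteProbability

/-! ### Product structure of the state law over blocks -/

section StateLaw

variable {K : Type*}

theorem sum_toReal_pmf {α : Type*} [Fintype α] (p : PMF α) : ∑ a, (p a).toReal = 1 := by
  rw [← ENNReal.toReal_sum fun a _ => p.apply_ne_top a, ← tsum_fintype (L := .unconditional α),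
    p.tsum_coe, ENNReal.toReal_one]

theorem stateLaw_nonneg (p : PMF (K × K)) (n : ℕ) (s) : 0 ≤ stateLaw p n s :=
  prod_nonneg fun _ _ => ENNReal.toReal_nonneg

/-- Sums over sequences of functions that factorize into blocks. -/
theorem sum_prod_blocks {J I R N α : Type*} [Fintype J] [Fintype I] [Fintype R] [Fintype N]
    [Fintype α] [DecidableEq J] [DecidableEq I] [DecidableEq R] [DecidableEq N]
    (e : (J × I) ⊕ R ≃ N) (f : J → (I → α) → ℝ) (ρ : (R → α) → ℝ) :
    ∑ x : N → α, (∏ j, f j fun i => x (e (.inl (j, i)))) * ρ (fun i => x (e (.inr i)))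
      = (∏ j, ∑ y, f j y) * ∑ y, ρ y := by
  let E : (N → α) ≃ (J → I → α) × (R → α) :=
    (e.symm.arrowCongr (Equiv.refl α)).trans
      ((Equiv.sumArrowEquivProdArrow _ _ _).trans
        ((Equiv.curry J I α).prodCongr (Equiv.refl _)))
  refine (Equiv.sum_comp E (fun y => (∏ j, f j (y.1 j)) * ρ y.2)).trans ?_
  rw [Fintype.sum_prod_type, prod_univ_sum, Fintype.piFinset_univ, sum_mul_sum]

/-- The part of a pair of state sequences in one of the blocks. -/
def block {J I R N : Type*} (e : (J × I) ⊕ R ≃ N) (s : (N → K) × (N → K)) (j : J) :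
    (I → K) × (I → K) :=
  (fun i => s.1 (e (.inl (j, i))), fun i => s.2 (e (.inl (j, i))))

variable {k n r N : ℕ}

theorem stateLaw_eq_prod_block (p : PMF (K × K)) (e : (Fin k × Fin n) ⊕ Fin r ≃ Fin N)
    (s : (Fin N → K) × (Fin N → K)) :
    stateLaw p N s = (∏ j, stateLaw p n (block e s j)) *
      ∏ i, (p (s.1 (e (.inr i)), s.2 (e (.inr i)))).toReal := by
  unfold stateLaw block
  rw [← Equiv.prod_comp e, Fintype.prod_sum_type, Fintype.prod_prod_type]

variable [Fintype K]

/-- Disjoint blocks are independent with the same law, and the leftover coordinates have total mass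
1. -/
theorem sum_stateLaw_mul_prod_block (p : PMF (K × K)) (e : (Fin k × Fin n) ⊕ Fin r ≃ Fin N)
    (φ : (Fin n → K) × (Fin n → K) → ℝ) :
    ∑ s, stateLaw p N s * ∏ j, φ (block e s j) = (∑ s, stateLaw p n s * φ s) ^ k := by
  classical
  have h := sum_prod_blocks e
    (fun _ (x : Fin n → K × K) => (∏ i, (p (x i)).toReal) * φ (fun i => (x i).1, fun i => (x i).2))
    (fun x : Fin r → K × K => ∏ i, (p (x i)).toReal)
  have h1 : ∑ x : Fin r → K × K, ∏ i, (p (x i)).toReal = 1 := by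
    have := prod_univ_sum (fun _ : Fin r => univ) (fun _ (a : K × K) => (p a).toReal)
    rw [Fintype.piFinset_univ] at this
    simp [← this, sum_toReal_pmf]
  rw [h1, mul_one, prod_const, card_univ, Fintype.card_fin] at h
  rw [← Equiv.sum_comp (Equiv.arrowProdEquivProdArrow (Fin N) (fun _ => K) (fun _ => K)),
    ← Equiv.sum_comp (Equiv.arrowProdEquivProdArrow (Fin n) (fun _ => K) (fun _ => K))]
  refine Eq.trans (sum_congr rfl fun x _ => ?_) h
  rw [stateLaw_eq_prod_block p e, prod_mul_distrib]
  simp only [stateLaw, block, Equiv.arrowProdEquivProdArrow, Equiv.coe_fn_mk]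
  ring

theorem sum_stateLaw (p : PMF (K × K)) (n : ℕ) : ∑ s, stateLaw p n s = 1 := by
  -- With no blocks, every coordinate is leftover and the right-hand side is a zeroth power.
  have h := sum_stateLaw_mul_prod_block (k := 0) (n := 0) (r := n) (N := n) p
    ((Equiv.emptySum _ _)) (fun _ => 1)
  simpa using h

end StateLaw

/-! ### Converse: a Fano-type bound -/

section Converse

variable {K : Type*} [Field K] [Fintype K]

/-- A Fano-type inequality: the error probability of a code bounds the logarithm of the number of
its messages. -/
theorem one_sub_errorProb_mul_logb_le (p : PMF (K × K)) (F : K → K → K) {n m : ℕ} (hm : 0 < m)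
    (enc : Fin m → (Fin n → K) → (Fin n → K)) (dec : (Fin n → K) → (Fin n → K) → Fin m) {H : ℝ}
    (hH : ∀ g : (Fin n → K) → (Fin n → K), H ≤
      condEntropy (stateLaw p n) (fun s => output F (g s.1) s.1 s.2) (fun s => s.2)) :
    (1 - errorProb p F enc dec) * Real.logb 2 m ≤
      n * Real.logb 2 (Fintype.card K) - H + 1 / Real.log 2 := by
  classical
  set q : ℝ := ((Fintype.card K : ℕ) : ℝ) with hq
  have hq0 : 0 < q := by
    rw [hq]
    exact_mod_cast Fintype.card_pos
  have hm0 : (0 : ℝ) < m := by exact_mod_cast hm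
  have hl2 : 0 < Real.log 2 := Real.log_pos one_lt_two
  have hP := stateLaw_nonneg p n
  -- The uniform weight on outputs, boosted by `m` where the decoder returns `i`: a correct decision
  -- lowers the cross-entropy by exactly `log m`.
  let w : Fin m → (Fin n → K) → (Fin n → K) → ℝ :=
    fun i s y => (if dec y s = i then (m : ℝ) else 1) / q ^ n
  have hw : ∀ i s y, 0 < w i s y := by
    intro i s y
    dsimp only [w]
    split_ifs <;> positivity
  let D : Fin m → (Fin n → K) × (Fin n → K) → ℝ :=
    fun i s => if dec (output F (enc i s.1) s.1 s.2) s.2 ≠ i then 1 else 0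
  have hlog : ∀ i s, -Real.logb 2 (w i s.2 (output F (enc i s.1) s.1 s.2)) =
      n * Real.logb 2 q - (1 - D i s) * Real.logb 2 m := by
    intro i s
    dsimp only [w, D]
    by_cases h : dec (output F (enc i s.1) s.1 s.2) s.2 = i
    · simp only [h, if_true, ne_eq, not_true, if_false]
      rw [Real.logb_div hm0.ne' (by positivity), Real.logb_pow]
      ring
    · simp only [h, if_false, ne_eq, not_false_iff, if_true]
      rw [Real.logb_div one_ne_zero (by positivity), Real.logb_pow, Real.logb_one]
      ring
  have hi : ∀ i, H ≤ ∑ s, stateLaw p n s * (n * Real.logb 2 q - (1 - D i s) * Real.logb 2 m) +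
      (∑ s, prob (stateLaw p n) {ω | ω.2 = s} * ∑ z, w i s z - 1) / Real.log 2 := by
    intro i
    refine (hH (enc i)).trans ((condEntropy_le hP (sum_stateLaw p n) _ _ (hw i)).trans_eq ?_)
    simp only [hlog]
  have hsum := sum_le_sum fun i (_ : i ∈ univ) => hi i
  rw [sum_add_distrib, sum_const, card_univ, Fintype.card_fin, nsmul_eq_mul, ← sum_div,
    sum_sub_distrib] at hsum
  -- Each output is boosted for exactly one message, so the weights have average mass at most 2 per
  -- message. The excess over 1 costs `1 / log 2`.
  have hwsum : ∀ s, ∑ i, ∑ z, w i s z ≤ 2 * m := by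
    intro s
    rw [sum_comm]
    have : ∀ z, ∑ i, w i s z ≤ 2 * m / q ^ n := by
      intro z
      simp only [w]
      rw [← sum_div]
      gcongr
      calc ∑ i, (if dec z s = i then (m : ℝ) else 1)
          ≤ ∑ i, ((if dec z s = i then (m : ℝ) else 0) + 1) := by
            refine sum_le_sum fun i _ => ?_
            split_ifs <;> simp
        _ = 2 * m := by
            rw [sum_add_distrib]
            simp
            ring
    refine (sum_le_sum fun z _ => this z).trans_eq ?_
    simp only [sum_const, card_univ, Fintype.card_fun, Fintype.card_fin, nsmul_eq_mul]
    push_cast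
    rw [← hq]
    field_simp
  have hA : ∑ i, ∑ s, prob (stateLaw p n) {ω | ω.2 = s} * ∑ z, w i s z ≤ 2 * m := by
    rw [sum_comm]
    calc _ ≤ ∑ s, prob (stateLaw p n) {ω | ω.2 = s} * (2 * m) := by
          refine sum_le_sum fun s _ => ?_
          rw [← mul_sum]
          exact mul_le_mul_of_nonneg_left (hwsum s) (prob_nonneg hP _)
      _ = 2 * m := by
          rw [← sum_mul, sum_prob_fiber, sum_stateLaw, one_mul]
  have hE : ∑ i, ∑ s, stateLaw p n s * D i s = m * errorProb p F enc dec := by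
    unfold errorProb prob
    rw [Fintype.sum_prod_type, mul_sum]
    refine sum_congr rfl fun i _ => ?_
    rw [mul_sum]
    refine sum_congr rfl fun s _ => ?_
    simp only [D, Set.indicator_apply, Set.mem_ofPred_eq, messageStateLaw]
    split_ifs
    · field_simp
    · simp
  have hB : ∑ i, ∑ s, stateLaw p n s * (n * Real.logb 2 q - (1 - D i s) * Real.logb 2 m) =
      m * (n * Real.logb 2 q) - m * ((1 - errorProb p F enc dec) * Real.logb 2 m) := by
    have : ∀ i s, stateLaw p n s * (n * Real.logb 2 q - (1 - D i s) * Real.logb 2 m) =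
      stateLaw p n s * (n * Real.logb 2 q - Real.logb 2 m) +
        stateLaw p n s * D i s * Real.logb 2 m := fun i s => by ring
    simp only [this, sum_add_distrib, ← sum_mul, hE, sum_stateLaw]
    simp
    ring
  rw [hB] at hsum
  have hC : (∑ i, ∑ s, prob (stateLaw p n) {ω | ω.2 = s} * ∑ z, w i s z - ∑ _i : Fin m, (1 : ℝ)) /
      Real.log 2 ≤ m * (1 / Real.log 2) := by
    rw [mul_one_div]
    gcongr
    simp
    linarith
  have : m * ((1 - errorProb p F enc dec) * Real.logb 2 m) ≤
      m * (n * Real.logb 2 q - H + 1 / Real.log 2) := by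
    linarith
  exact le_of_mul_le_mul_left this hm0

end Converse

/-! ### Random coding over the group of sequences -/

section RandomCoding

/-- Averaged over all codebooks, two different codewords differ by a uniform element. -/
theorem sum_codebook_indicator {G ι : Type*} [AddCommGroup G] [Fintype G] [DecidableEq G]
    [Fintype ι] [DecidableEq ι] (A : Finset G) (z : G) {i j : ι} (hij : j ≠ i) :
    ∑ c : ι → G, (if c i + z - c j ∈ A then (1 : ℝ) else 0) =
      Fintype.card (ι → G) * (#A / Fintype.card G) := by
  have hG : (Fintype.card G : ℝ) ≠ 0 := by exact_mod_cast Fintype.card_ne_zero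
  have h1 : ∀ t : G, ∑ c : ι → G, (if c i + z - c j ∈ A then (1 : ℝ) else 0) =
      ∑ c : ι → G, (if c i + t + z - c j ∈ A then (1 : ℝ) else 0) := by
    intro t
    -- Translating only the `i`-th codeword permutes the codebooks and leaves `c j` fixed. Averaging
    -- over `t` then makes the difference uniform.
    rw [← Equiv.sum_comp (Equiv.addRight (Pi.single i t : ι → G))]
    simp [hij]
  have h2 : ∀ c : ι → G, ∑ t : G, (if c i + t + z - c j ∈ A then (1 : ℝ) else 0) = #A := by
    intro c
    have : ∀ t, c i + t + z - c j = Equiv.addRight (c i + z - c j) t := fun t => by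
      simp only [Equiv.coe_addRight]
      abel
    simp only [this]
    rw [Equiv.sum_comp (Equiv.addRight (c i + z - c j)) (fun t => if t ∈ A then (1 : ℝ) else 0)]
    simp
  have h3 := sum_congr rfl fun t (_ : t ∈ (univ : Finset G)) => h1 t
  rw [sum_const, sum_comm, nsmul_eq_mul, card_univ] at h3
  simp only [h2, sum_const, card_univ, nsmul_eq_mul] at h3
  field_simp
  linarith

variable {K : Type*} [Field K] [Fintype K]

open Classical in
/-- Random coding for the additive channel whose noise, given the decoder's state, is typically in
a small set. -/
theorem exists_code (p : PMF (K × K)) (F : K → K → K) {n m : ℕ} (hm : 0 < m)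
    (g : (Fin n → K) → (Fin n → K)) (A : (Fin n → K) → Finset (Fin n → K)) {B : ℝ}
    (hA : ∀ s, (#(A s) : ℝ) ≤ B) :
    ∃ (enc : Fin m → (Fin n → K) → (Fin n → K)) (dec : (Fin n → K) → (Fin n → K) → Fin m),
      errorProb p F enc dec ≤
        prob (stateLaw p n) {s | output F (g s.1) s.1 s.2 ∉ A s.2} +
          m * B / (Fintype.card K : ℝ) ^ n := by
  have hB : 0 ≤ B := (Nat.cast_nonneg _).trans (hA 0)
  have hm0 : (0 : ℝ) < m := by exact_mod_cast hm
  have hP := stateLaw_nonneg p n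
  let enc : (Fin m → Fin n → K) → Fin m → (Fin n → K) → (Fin n → K) := fun c i s => c i + g s
  let dec : (Fin m → Fin n → K) → (Fin n → K) → (Fin n → K) → Fin m := fun c y s =>
    if h : ∃ j, y - c j ∈ A s then h.choose else ⟨0, hm⟩
  let Z : (Fin n → K) × (Fin n → K) → (Fin n → K) := fun s => output F (g s.1) s.1 s.2
  let T : (Fin n → K) × (Fin n → K) → ℝ := fun s => if Z s ∉ A s.2 then 1 else 0
  have hout : ∀ c i s, output F (enc c i s.1) s.1 s.2 = c i + Z s := by
    intro c i s
    funext l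
    simp only [output, enc, Z, Pi.add_apply]
    ring
  -- If the noise lies in `A`, the sent index is a candidate, so an error means that the chosen
  -- candidate is another `j` counted in the sum.
  have herr : ∀ c i s, (if dec c (c i + Z s) s.2 ≠ i then (1 : ℝ) else 0) ≤
      T s + ∑ j ∈ univ.erase i, if c i + Z s - c j ∈ A s.2 then (1 : ℝ) else 0 := by
    intro c i s
    have hnn : ∀ j ∈ univ.erase i, (0 : ℝ) ≤ if c i + Z s - c j ∈ A s.2 then (1 : ℝ) else 0 :=
      fun j _ => by positivity
    by_cases hT : Z s ∈ A s.2
    · have hex : ∃ j, c i + Z s - c j ∈ A s.2 := ⟨i, by simpa using hT⟩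
      have hT0 : T s = 0 := by simp [T, hT]
      rw [hT0, zero_add]
      split_ifs with hd
      · have hdec : dec c (c i + Z s) s.2 = hex.choose := by simp only [dec, dif_pos hex]
        rw [hdec] at hd
        refine le_trans ?_ (single_le_sum hnn (mem_erase.2 ⟨hd, mem_univ _⟩))
        rw [if_pos hex.choose_spec]
      · exact sum_nonneg hnn
    · have hT1 : T s = 1 := by simp [T, hT]
      have := sum_nonneg hnn
      rw [hT1]
      split_ifs <;> linarith
  have hcode : ∀ c, errorProb p F (enc c) (dec c) ≤ ∑ i : Fin m, ∑ s, 1 / (m : ℝ) *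
      (stateLaw p n s * (T s + ∑ j ∈ univ.erase i,
        if c i + Z s - c j ∈ A s.2 then (1 : ℝ) else 0)) := by
    intro c
    unfold errorProb prob
    rw [Fintype.sum_prod_type]
    refine sum_le_sum fun i _ => sum_le_sum fun s _ => ?_
    have := mul_le_mul_of_nonneg_left (mul_le_mul_of_nonneg_left (herr c i s) (hP s))
      (show 0 ≤ 1 / (m : ℝ) by positivity)
    refine le_trans (le_of_eq ?_) this
    simp only [Set.indicator_apply, Set.mem_ofPred_eq, messageStateLaw, hout]
    split_ifs <;> simp
  set C : ℝ := ((Fintype.card (Fin m → Fin n → K) : ℕ) : ℝ) with hC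
  set q : ℝ := ((Fintype.card K : ℕ) : ℝ) with hq
  have hG : (Fintype.card (Fin n → K) : ℝ) = q ^ n := by simp [hq]
  have hq0 : 0 < q := by
    rw [hq]
    exact_mod_cast Fintype.card_pos
  have hprob : prob (stateLaw p n) {s | Z s ∉ A s.2} = ∑ s, stateLaw p n s * T s := by
    refine sum_congr rfl fun s _ => ?_
    simp only [Set.indicator_apply, Set.mem_ofPred_eq, T]
    split_ifs <;> simp
  have havg : ∑ c, errorProb p F (enc c) (dec c) ≤
      ∑ _c : Fin m → Fin n → K, (prob (stateLaw p n) {s | Z s ∉ A s.2} + m * B / q ^ n) := by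
    refine (sum_le_sum fun c _ => hcode c).trans ?_
    rw [sum_comm, sum_const, card_univ, nsmul_eq_mul, ← hC]
    have hi : ∀ i : Fin m, ∑ c : Fin m → Fin n → K, ∑ s, 1 / (m : ℝ) *
      (stateLaw p n s * (T s + ∑ j ∈ univ.erase i,
        if c i + Z s - c j ∈ A s.2 then (1 : ℝ) else 0)) ≤
        1 / m * (C * (prob (stateLaw p n) {s | Z s ∉ A s.2} + m * B / q ^ n)) := by
      intro i
      rw [sum_comm]
      simp only [← mul_sum]
      refine mul_le_mul_of_nonneg_left ?_ (by positivity)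
      have hs : ∀ s, ∑ c : Fin m → Fin n → K, (T s + ∑ j ∈ univ.erase i,
          if c i + Z s - c j ∈ A s.2 then (1 : ℝ) else 0) ≤ C * (T s + m * B / q ^ n) := by
        intro s
        rw [sum_add_distrib, sum_comm, sum_congr rfl fun j hj =>
          sum_codebook_indicator (A s.2) (Z s) (mem_erase.1 hj).1]
        rw [sum_const, sum_const, nsmul_eq_mul, nsmul_eq_mul, card_univ, ← hC, hG, mul_add]
        have hcard : (#(univ.erase i) : ℝ) ≤ m := by
          have := card_le_univ (univ.erase i)
          rw [Fintype.card_fin] at this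
          exact_mod_cast this
        have : (#(univ.erase i) : ℝ) * (C * (#(A s.2) / q ^ n)) ≤ m * (C * (B / q ^ n)) := by
          gcongr
          exact hA _
        have e : (m : ℝ) * (C * (B / q ^ n)) = C * (m * B / q ^ n) := by ring
        linarith
      calc _ ≤ ∑ s, stateLaw p n s * (C * (T s + m * B / q ^ n)) :=
            sum_le_sum fun s _ => mul_le_mul_of_nonneg_left (hs s) (hP s)
        _ = C * (∑ s, stateLaw p n s * T s + (∑ s, stateLaw p n s) * (m * B / q ^ n)) := by
            rw [sum_mul, ← sum_add_distrib, mul_sum]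
            exact sum_congr rfl fun s _ => by ring
        _ = _ := by rw [sum_stateLaw, one_mul, hprob]
    refine (sum_le_sum fun i _ => hi i).trans_eq ?_
    rw [sum_const, card_univ, Fintype.card_fin, nsmul_eq_mul]
    field_simp
  obtain ⟨c, -, hc⟩ := exists_le_of_sum_le univ_nonempty havg
  exact ⟨enc c, dec c, hc⟩

end RandomCoding

/-! ### Typical noise by Chernoff's bound -/

section Typicality

/-- Chernoff's method: a function with mean below `c` has an exponential moment below that of the
constant `c`. -/
theorem exists_sum_mul_exp_lt_one {Ω : Type*} [Fintype Ω] {P : Ω → ℝ} (hP1 : ∑ ω, P ω = 1)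
    {X : Ω → ℝ} {c : ℝ} (h : ∑ ω, P ω * X ω < c) :
    ∃ t : ℝ, 0 < t ∧ ∑ ω, P ω * Real.exp (t * (X ω - c)) < 1 := by
  -- The moment is 1 at `t = 0` and its derivative there is the mean minus `c`, which is negative.
  have hd : HasDerivAt (fun t : ℝ => ∑ ω, P ω * Real.exp (t * (X ω - c)))
      (∑ ω, P ω * (X ω - c)) 0 := by
    refine HasDerivAt.fun_sum fun ω _ => ?_
    have h1 : HasDerivAt (fun t : ℝ => t * (X ω - c)) (X ω - c) 0 := by
      simpa using (hasDerivAt_id (0 : ℝ)).mul_const (X ω - c)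
    simpa using h1.exp.const_mul (P ω)
  have hneg : ∑ ω, P ω * (X ω - c) < 0 := by
    simp only [mul_sub, sum_sub_distrib, ← sum_mul, hP1]
    linarith
  have hev := (hasDerivAt_iff_tendsto_slope.1 hd).eventually (gt_mem_nhds hneg)
  have hle : 𝓝[>] (0 : ℝ) ≤ 𝓝[≠] 0 := nhdsWithin_mono 0 fun t (ht : 0 < t) => ht.ne'
  obtain ⟨t, hslope, ht⟩ := ((hev.filter_mono hle).and self_mem_nhdsWithin).exists
  refine ⟨t, ht, ?_⟩
  rw [slope_def_field, sub_zero, div_lt_iff₀ ht, zero_mul] at hslope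
  simpa [hP1] using hslope

variable {K : Type*} [Field K] [Fintype K]

open Classical in
/-- Blockwise use of `g` makes the noise lie in a set of exponential size determined by any
`c > H(g(S₁ⁿ) + F(S₁ⁿ, S₂ⁿ) | S₂ⁿ)`, except with exponentially small probability. -/
theorem exists_typical_set (p : PMF (K × K)) (F : K → K → K) {n : ℕ}
    (g : (Fin n → K) → (Fin n → K)) {c : ℝ}
    (hc : condEntropy (stateLaw p n) (fun s => output F (g s.1) s.1 s.2) (fun s => s.2) < c) :
    ∃ ρ : ℝ, 0 ≤ ρ ∧ ρ < 1 ∧ ∀ k r N : ℕ, N = k * n + r →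
      ∃ (g' : (Fin N → K) → (Fin N → K)) (A : (Fin N → K) → Finset (Fin N → K)),
        (∀ s, (#(A s) : ℝ) ≤ (2 : ℝ) ^ (k * c) * (Fintype.card K : ℝ) ^ r) ∧
        prob (stateLaw p N) {s | output F (g' s.1) s.1 s.2 ∉ A s.2} ≤ ρ ^ k := by
  have hP := stateLaw_nonneg p n
  let Z : (Fin n → K) × (Fin n → K) → (Fin n → K) := fun s => output F (g s.1) s.1 s.2
  let Q : (Fin n → K) → (Fin n → K) → ℝ :=
    fun s z => condProb (stateLaw p n) {ω | Z ω = z} {ω | ω.2 = s}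
  have hQ0 : ∀ s z, 0 ≤ Q s z := fun s z => condProb_nonneg hP _ _
  rw [condEntropy_eq_sum hP] at hc
  obtain ⟨t, ht, hρ⟩ := exists_sum_mul_exp_lt_one (sum_stateLaw p n) hc
  refine ⟨_, sum_nonneg fun s _ => mul_nonneg (hP s) (Real.exp_nonneg _), hρ, ?_⟩
  rintro k r N rfl
  let e : (Fin k × Fin n) ⊕ Fin r ≃ Fin (k * n + r) := Fintype.equivOfCardEq (by simp)
  let blk : (Fin (k * n + r) → K) → Fin k → Fin n → K := fun x j i => x (e (.inl (j, i)))
  let g' : (Fin (k * n + r) → K) → Fin (k * n + r) → K := fun x l =>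
    Sum.elim (fun ji => g (blk x ji.1) ji.2) (fun _ => 0) (e.symm l)
  -- The product of conditional probabilities is thresholded, so at most `2 ^ (k * c)` block parts
  -- qualify. The leftover coordinates are free, whence the factor `q ^ r`.
  let A : (Fin (k * n + r) → K) → Finset (Fin (k * n + r) → K) := fun s =>
    {z | (2 : ℝ) ^ (-(k * c)) ≤ ∏ j, Q (blk s j) (blk z j)}
  refine ⟨g', A, fun s => ?_, ?_⟩
  · have h1 : (#(A s) : ℝ) * (2 : ℝ) ^ (-(k * c)) ≤ ∑ z, ∏ j, Q (blk s j) (blk z j) := by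
      rw [← nsmul_eq_mul]
      refine (card_nsmul_le_sum (A s) _ _ fun z hz => (mem_filter.1 hz).2).trans ?_
      exact sum_le_sum_of_subset_of_nonneg (subset_univ _)
        fun z _ _ => prod_nonneg fun j _ => hQ0 _ _
    have h2 := sum_prod_blocks e (fun j => Q (blk s j)) (fun _ => 1)
    simp only [mul_one, sum_const, card_univ, Fintype.card_fun, Fintype.card_fin, nsmul_eq_mul,
      Nat.cast_pow] at h2
    have h3 : ∏ j, ∑ y, Q (blk s j) y ≤ 1 :=
      prod_le_one (fun j _ => sum_nonneg fun y _ => hQ0 _ _) fun j _ => sum_condProb_le_one _ _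
    have h4 : (#(A s) : ℝ) * (2 : ℝ) ^ (-(k * c)) ≤ (Fintype.card K : ℝ) ^ r := by
      refine h1.trans (h2.le.trans ?_)
      exact mul_le_of_le_one_left (by positivity) h3
    rw [Real.rpow_neg two_pos.le, ← div_eq_mul_inv, div_le_iff₀ (by positivity)] at h4
    linarith
  · rw [← sum_stateLaw_mul_prod_block p e]
    refine sum_le_sum fun s _ => ?_
    have hN := stateLaw_nonneg p _ s
    by_cases hs : output F (g' s.1) s.1 s.2 ∉ A s.2
    swap
    · rw [Set.indicator_of_notMem (by simpa using hs)]
      exact mul_nonneg hN (prod_nonneg fun j _ => Real.exp_nonneg _)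
    rw [Set.indicator_of_mem (by simpa using hs)]
    rcases hN.eq_or_lt with h0 | hpos
    · rw [← h0, zero_mul]
    -- Markov's inequality pointwise: outside `A` the information densities of the blocks sum to
    -- more than `k * c`, so the exponential is at least 1.
    refine le_mul_of_one_le_right hN ?_
    rw [← Real.exp_sum, ← mul_sum]
    refine Real.one_le_exp (mul_nonneg ht.le ?_)
    have hblk : ∀ j, blk (output F (g' s.1) s.1 s.2) j = Z (block e s j) := by
      intro j
      funext i
      simp [blk, output, g', Z, block]
    have hbpos : ∀ j, 0 < stateLaw p n (block e s j) := by
      intro j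
      rw [stateLaw_eq_prod_block p e] at hpos
      refine (hP _).lt_of_ne fun h => ?_
      rw [prod_eq_zero (mem_univ j) h.symm, zero_mul] at hpos
      exact lt_irrefl _ hpos
    have hQpos : ∀ j, 0 < Q (block e s j).2 (Z (block e s j)) := fun j =>
      condProb_pos hP (hbpos j) rfl rfl
    have hlt : ∏ j, Q (block e s j).2 (Z (block e s j)) < (2 : ℝ) ^ (-(k * c)) := by
      have := hs
      simp only [A, mem_filter, mem_univ, true_and, not_le, hblk] at this
      exact this
    have := Real.logb_lt_logb one_lt_two (prod_pos fun j _ => hQpos j) hlt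
    rw [Real.logb_rpow two_pos (by norm_num), Real.logb_prod _ _ fun j _ => (hQpos j).ne'] at this
    simp only [sum_sub_distrib, sum_neg_distrib, sum_const, card_univ, Fintype.card_fin,
      nsmul_eq_mul]
    simp only [Q, Z] at this
    linarith

end Typicality

/-! ### The two bounds on the capacity -/

section Capacity

variable {K : Type*} [Field K] [Fintype K]

/-- Achievable rates are nonnegative by definition, so this covers the negative numbers in the least
upper bound argument. -/
theorem isAchievable_zero (p : PMF (K × K)) (F : K → K → K) : IsAchievable p F 0 := by
  refine ⟨le_rfl, fun ε hε => ⟨0, fun n _ => ?_⟩⟩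
  have h1 : ⌈(2 : ℝ) ^ ((n : ℝ) * 0)⌉₊ = 1 := by simp
  rw [h1]
  refine ⟨fun _ => id, fun _ _ => 0, ?_⟩
  refine le_trans (le_of_eq ?_) hε.le
  unfold errorProb prob
  refine sum_eq_zero fun ω _ => Set.indicator_of_notMem ?_ _
  simp only [Set.mem_ofPred_eq, not_not]
  exact Subsingleton.elim _ _

theorem isAchievable_of_lt (p : PMF (K × K)) (F : K → K → K) {n : ℕ} (hn : 1 ≤ n)
    (g : (Fin n → K) → (Fin n → K)) {R : ℝ} (hR : 0 ≤ R)
    (h : R < Real.logb 2 (Fintype.card K) - entropyRate p F n g) : IsAchievable p F R := by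
  classical
  set q : ℝ := ((Fintype.card K : ℕ) : ℝ) with hq
  have hq0 : 0 < q := by
    rw [hq]
    exact_mod_cast Fintype.card_pos
  have hn0 : (0 : ℝ) < n := by exact_mod_cast hn
  have h' : condEntropy (stateLaw p n) (fun s => output F (g s.1) s.1 s.2) (fun s => s.2) <
      n * Real.logb 2 q - n * R := by
    unfold entropyRate at h
    rw [lt_sub_comm, one_div, inv_mul_lt_iff₀ hn0, mul_sub] at h
    exact h
  obtain ⟨c, hc1, hc2⟩ := exists_between h'
  obtain ⟨ρ, hρ0, hρ1, H⟩ := exists_typical_set p F g hc1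
  set σ : ℝ := (2 : ℝ) ^ (n * R + c) / q ^ n with hσ
  have hσ0 : 0 ≤ σ := by positivity
  have hσ1 : σ < 1 := by
    rw [hσ, div_lt_one (by positivity)]
    calc (2 : ℝ) ^ (n * R + c) < 2 ^ (n * Real.logb 2 q) :=
          Real.rpow_lt_rpow_of_exponent_lt one_lt_two (by linarith)
      _ = q ^ n := by
          rw [mul_comm, Real.rpow_mul two_pos.le, Real.rpow_logb two_pos (by norm_num) hq0,
            Real.rpow_natCast]
  refine ⟨hR, fun ε hε => ?_⟩
  -- The factor 2 absorbs the ceiling in the number of messages, and `2 ^ (n * R)` the fewer than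
  -- `n` leftover coordinates.
  have hlim : Tendsto (fun k : ℕ => ρ ^ k + 2 * 2 ^ (n * R) * σ ^ k) atTop (𝓝 0) := by
    simpa using (tendsto_pow_atTop_nhds_zero_of_lt_one hρ0 hρ1).add
      ((tendsto_pow_atTop_nhds_zero_of_lt_one hσ0 hσ1).const_mul (2 * 2 ^ (n * R)))
  have hev := (hlim.comp (Nat.tendsto_div_const_atTop (n := n) (by omega))).eventually
    (gt_mem_nhds hε)
  obtain ⟨N₀, hN₀⟩ := eventually_atTop.1 hev
  refine ⟨N₀, fun N hN => ?_⟩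
  have hk := hN₀ N hN
  set k := N / n with hkdef
  set r := N % n with hrdef
  have hN' : N = k * n + r := (Nat.div_add_mod' N n).symm
  have hr : (r : ℝ) ≤ n := by exact_mod_cast (Nat.mod_lt N (by omega)).le
  obtain ⟨g', A, hA, hprob⟩ := H k r N hN'
  have hx : (1 : ℝ) ≤ 2 ^ ((N : ℝ) * R) := Real.one_le_rpow one_le_two (by positivity)
  have hm : 0 < ⌈(2 : ℝ) ^ ((N : ℝ) * R)⌉₊ := Nat.ceil_pos.2 (by linarith)
  obtain ⟨enc, dec, hcode⟩ := exists_code p F hm g' A hA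
  refine ⟨enc, dec, hcode.trans ((add_le_add hprob ?_).trans hk.le)⟩
  have hm2 : (⌈(2 : ℝ) ^ ((N : ℝ) * R)⌉₊ : ℝ) ≤ 2 * 2 ^ ((N : ℝ) * R) := by
    have := (Nat.ceil_lt_add_one (zero_le_one.trans hx)).le
    linarith
  have hpow : (2 : ℝ) ^ ((N : ℝ) * R) ≤ 2 ^ (n * R) * (2 ^ (n * R)) ^ k := by
    rw [← Real.rpow_mul_natCast two_pos.le, ← Real.rpow_add two_pos]
    refine Real.rpow_le_rpow_of_exponent_le one_le_two ?_
    rw [hN']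
    push_cast
    nlinarith [mul_le_mul_of_nonneg_right hr hR]
  have hσk : σ ^ k = (2 ^ (n * R)) ^ k * 2 ^ (k * c) / q ^ (k * n) := by
    rw [hσ, div_pow, Real.rpow_add two_pos, mul_pow, ← pow_mul, mul_comm n k,
      mul_comm (k : ℝ) c, Real.rpow_mul_natCast two_pos.le]
  rw [← hq]
  calc _ ≤ 2 * (2 ^ (n * R) * (2 ^ (n * R)) ^ k) * (2 ^ (k * c) * q ^ r) / q ^ N := by
        gcongr
        exact hm2.trans (by gcongr)
    _ = 2 * 2 ^ (n * R) * σ ^ k := by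
        rw [hσk, hN', pow_add]
        field_simp

theorem le_of_isAchievable (p : PMF (K × K)) (F : K → K → K) {h : ℝ}
    (hh : h ∈ lowerBounds (entropyRates p F)) {R : ℝ} (hR : IsAchievable p F R) :
    R ≤ Real.logb 2 (Fintype.card K) - h := by
  obtain ⟨hR0, hR⟩ := hR
  have key : ∀ ε : ℝ, 0 < ε → ε < 1 → (1 - ε) * R ≤ Real.logb 2 (Fintype.card K) - h := by
    intro ε hε hε1
    obtain ⟨N, hN⟩ := hR ε hε
    have hlim : Tendsto (fun n : ℕ => Real.logb 2 (Fintype.card K) - h +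
        1 / Real.log 2 * (1 / (n : ℝ))) atTop
        (𝓝 (Real.logb 2 (Fintype.card K) - h + 1 / Real.log 2 * 0)) :=
      tendsto_const_nhds.add (tendsto_one_div_atTop_nhds_zero_nat.const_mul _)
    rw [mul_zero, add_zero] at hlim
    refine ge_of_tendsto hlim ?_
    filter_upwards [eventually_ge_atTop N, eventually_ge_atTop 1] with n hnN hn1
    have hn0 : (0 : ℝ) < n := by exact_mod_cast hn1
    obtain ⟨enc, dec, hcode⟩ := hN n hnN
    have hm : 0 < ⌈(2 : ℝ) ^ ((n : ℝ) * R)⌉₊ := Nat.ceil_pos.2 (by positivity)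
    have hconv := one_sub_errorProb_mul_logb_le p F hm enc dec (H := n * h) fun g => by
      have := hh ⟨n, hn1, g, rfl⟩
      unfold entropyRate at this
      rwa [one_div, ← div_eq_inv_mul, le_div_iff₀' hn0] at this
    have hlog : n * R ≤ Real.logb 2 ⌈(2 : ℝ) ^ ((n : ℝ) * R)⌉₊ := by
      rw [Real.le_logb_iff_rpow_le one_lt_two (by exact_mod_cast hm)]
      exact Nat.le_ceil _
    have h1 : (1 - ε) * (n * R) ≤ n * Real.logb 2 (Fintype.card K) - n * h + 1 / Real.log 2 :=
      (mul_le_mul (by linarith) hlog (by positivity) (by linarith)).trans hconv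
    have h2 : n * ((1 - ε) * R) ≤
        n * (Real.logb 2 (Fintype.card K) - h + 1 / Real.log 2 * (1 / n)) := by
      have e : n * (Real.logb 2 (Fintype.card K) - h + 1 / Real.log 2 * (1 / n)) =
        n * Real.logb 2 (Fintype.card K) - n * h + 1 / Real.log 2 := by field_simp
      linarith
    exact le_of_mul_le_mul_left h2 hn0
  -- The bound loses the factor `1 - ε`, so it becomes sharp only as `ε` tends to 0.
  have hlim : Tendsto (fun ε : ℝ => (1 - ε) * R) (𝓝[>] 0) (𝓝 R) := by
    have : Tendsto (fun ε : ℝ => (1 - ε) * R) (𝓝 0) (𝓝 ((1 - 0) * R)) :=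
      Continuous.tendsto (by fun_prop) 0
    rw [sub_zero, one_mul] at this
    exact this.mono_left nhdsWithin_le_nhds
  refine le_of_tendsto hlim ?_
  filter_upwards [Ioo_mem_nhdsGT (zero_lt_one' ℝ)] with ε hε using key ε hε.1 hε.2

end Capacity

end TwoStateChannel

theorem lemma3 {K : Type*} [Field K] [Fintype K] (p : PMF (K × K)) (F : K → K → K) :
    ∃ h : ℝ, IsGLB (TwoStateChannel.entropyRates p F) h ∧
      TwoStateChannel.IsCapacity p F (Real.logb 2 (Fintype.card K) - h) := by
  have hglb : IsGLB (TwoStateChannel.entropyRates p F)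
      (sInf (TwoStateChannel.entropyRates p F)) := by
    refine isGLB_csInf ⟨_, 1, le_rfl, id, rfl⟩ ⟨0, ?_⟩
    rintro _ ⟨n, -, g, rfl⟩
    exact mul_nonneg (by positivity)
      (TwoStateChannel.condEntropy_nonneg (TwoStateChannel.stateLaw_nonneg p n) _ _)
  refine ⟨_, hglb, fun R hR => TwoStateChannel.le_of_isAchievable p F hglb.1 hR, fun b hb => ?_⟩
  refine le_of_forall_lt fun R hR => ?_
  obtain ⟨R', hR', hR'2⟩ := exists_between hR
  refine hR'.trans_le ?_
  rcases lt_or_ge R' 0 with h0 | h0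
  · exact h0.le.trans (hb (TwoStateChannel.isAchievable_zero p F))
  obtain ⟨_, ⟨n, hn, g, rfl⟩, hg⟩ := (isGLB_lt_iff hglb).1 (lt_sub_comm.1 hR'2)
  exact hb (TwoStateChannel.isAchievable_of_lt p F hn g h0 (by linarith))
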